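/- A Hausdorff space $X$ is called $0$-dimensional if its clopen subsets form a basis. A function $f\colon X\to\mathbb{Z}$ is $k$-continuous if its restriction to every compact subset of $X$ is continuous, and a $0$-dimensional space $X$ is a $k_{\mathbb{N}}$-space if its topology is the smallest one making all $k$-continuous functions $X\to\mathbb{Z}$ continuous. Let $C_p(X,\mathbb{Z})$ be the group of continuous functions $X\to\mathbb{Z}$ ($\mathbb{Z}$ discrete) with the topology of pointwise convergence on $X$, let $A_p(X)$ be the free abelian group on $X$ with the topology of pointwise convergence on $C(X,\mathbb{Z})$ under the pairing $\langle\sum_x n_x x, f\rangle=\sum_x n_x f(x)$, and let $\mathbb{T}=\mathbb{R}/\mathbb{Z}$. The dual group $\widehat{G}$ of a topological abelian group $G$ is the group of its continuous characters $G\to\mathbb{T}$. For $x\in\mathbb{T}$ let $|x|$ be its distance to $0$; a set $A\subseteq G$ is quasi-convex if every $g\in G$ with $|\chi(g)|\le\frac14$ for all $\chi\in\widehat{G}$ satisfying $|\chi|\le\frac14$ on $A$ belongs to $A$, and $G$ is locally quasi-convex if it has a neighbourhood base at $0$ of quasi-convex sets. Let $\mathcal{Q}$ be the class of Hausdorff locally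 quasi-convex topological abelian groups. A continuous bihomomorphism is a biadditive, separately continuous map that is continuous at $(0,0)$, and $G\otimes_{\mathcal{Q}}H$, with its map $(g,h)\mapsto g\otimes h$, denotes the $\mathcal{Q}$-tensor product: the universal continuous bihomomorphism from $G\times H$ into a group of $\mathcal{Q}$ (every continuous bihomomorphism from $G\times H$ into a group of $\mathcal{Q}$ factors through it by a unique continuous homomorphism). **Theorem B.** Let $X$ be a $0$-dimensional (Hausdorff) $k_{\mathbb{N}}$-space. Then the $\mathcal{Q}$-tensor product $C_p(X,\mathbb{Z})\otimes_{\mathcal{Q}}\mathbb{T}$ exists (it is the largest Hausdorff quotient of the algebraic tensor product with the finest locally quasi-convex group topology making $(f,t)\mapsto f\otimes t$ a continuous bihomomorphism), and there is an isomorphism of abstract groups $$\theta\colon C_p(X,\mathbb{Z})\otimes_{\mathcal{Q}}\mathbb{T}\;\longrightarrow\;\widehat{A_p(X)},\qquad \theta(f\otimes t)(a)=\langle a,f\rangle\, t\quad (f\in C(X,\mathbb{Z}),\ t\in\mathbb{T},\ a\in A(X)).$$ -/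

import Mathlib

open Topology TopologicalSpace
open scoped TensorProduct

universe u v w

noncomputable section

/-! ### Zero-dimensional spaces and `k_ℕ`-spaces -/

/-- The clopen subsets form a basis of the topology. -/
def IsZeroDim (X : Type u) [TopologicalSpace X] : Prop :=
  IsTopologicalBasis {U : Set X | IsClopen U}

/-- An integer-valued function is `k`-continuous if its restriction to each compact subspace is
continuous. -/
def IsKContinuous {X : Type u} [TopologicalSpace X] (f : X → ℤ) : Prop :=
  ∀ K : Set X, IsCompact K → ContinuousOn f K

/-- The topology of `k_ℕ X`: the smallest topology on the set `X` for which every `k`-continuous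
`ℤ`-valued function is continuous. -/
abbrev kNTopology (X : Type u) [TopologicalSpace X] : TopologicalSpace X :=
  ⨅ f : {f : X → ℤ // IsKContinuous f}, TopologicalSpace.induced f.1 inferInstance

/-- `X` is a `k_ℕ`-space if `k_ℕ X = X`. -/
def IsKNSpace (X : Type u) [t : TopologicalSpace X] : Prop :=
  kNTopology X = t

/-! ### The groups `C_p(X, ℤ)` and `A_p(X)` -/

/-- `C_p(X, ℤ)`: the group of continuous integer-valued functions. It carries the topology of
pointwise convergence, namely the subspace topology from the product `X → ℤ`. -/
def Cp (X : Type u) [TopologicalSpace X] : AddSubgroup (X → ℤ) where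
  carrier := {f | Continuous f}
  zero_mem' := continuous_const
  add_mem' hf hg := Continuous.add hf hg
  neg_mem' hf := Continuous.neg hf

/-- `A_p(X)`: the free abelian group on the set `X`. -/
def Ap (X : Type u) : Type u := FreeAbelianGroup X

instance (X : Type u) : AddCommGroup (Ap X) := inferInstanceAs (AddCommGroup (FreeAbelianGroup X))

/-- The pairing `⟨∑ nₓ x, f⟩ = ∑ nₓ f(x)` of `A(X)` with integer-valued functions. -/
def Ap.eval {X : Type u} (f : X → ℤ) : Ap X →+ ℤ := FreeAbelianGroup.lift f

/-- The topology `t_p(C(X, ℤ))` on `A(X)` of pointwise convergence on `C(X, ℤ)`. -/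
instance (X : Type u) [TopologicalSpace X] : TopologicalSpace (Ap X) :=
  TopologicalSpace.induced (fun (a : Ap X) (f : Cp X) => Ap.eval f.1 a) Pi.topologicalSpace

/-! ### Dual groups and locally quasi-convex groups -/

/-- The dual group: all continuous characters into `𝕋 = ℝ/ℤ` (with the compact-open topology). -/
abbrev DualGroup (G : Type u) [AddCommGroup G] [TopologicalSpace G] : Type u :=
  ContinuousAddMonoidHom G UnitAddCircle

/-- `A` is quasi-convex: it equals its bipolar. Here `‖x‖` is the distance of `x ∈ ℝ/ℤ` to `0`. -/
def IsQuasiConvex {G : Type u} [AddCommGroup G] [TopologicalSpace G] (A : Set G) : Prop :=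
  {g : G | ∀ χ : DualGroup G, (∀ a ∈ A, ‖χ a‖ ≤ 1 / 4) → ‖χ g‖ ≤ 1 / 4} = A

/-- There is a neighbourhood base at `0` of quasi-convex sets. -/
def IsLocallyQuasiConvex (G : Type u) [AddCommGroup G] [TopologicalSpace G] : Prop :=
  ∀ V ∈ 𝓝 (0 : G), ∃ U ∈ 𝓝 (0 : G), IsQuasiConvex U ∧ U ⊆ V

/-- The class `𝒬` of Hausdorff locally quasi-convex topological abelian groups. -/
structure IsQGroup (G : Type u) [AddCommGroup G] [TopologicalSpace G] : Prop where
  isTopologicalAddGroup : IsTopologicalAddGroup G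
  t2 : T2Space G
  locallyQuasiConvex : IsLocallyQuasiConvex G

/-! ### Tensor products of topological abelian groups -/

section Tensor

variable (G : Type u) (H : Type v) [AddCommGroup G] [TopologicalSpace G]
  [AddCommGroup H] [TopologicalSpace H]

/-- Continuous bihomomorphisms: biadditive, separately continuous, and continuous at `(0, 0)`. -/
structure IsContBihom {G : Type u} {H : Type v} {A : Type w} [AddCommGroup G] [TopologicalSpace G]
    [AddCommGroup H] [TopologicalSpace H] [AddCommGroup A] [TopologicalSpace A]
    (b : G → H → A) : Prop where
  add_left : ∀ g g' h, b (g + g') h = b g h + b g' h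
  add_right : ∀ g h h', b g (h + h') = b g h + b g h'
  continuous_left : ∀ h, Continuous fun g => b g h
  continuous_right : ∀ g, Continuous fun h => b g h
  continuousAt_zero : ContinuousAt (fun p : G × H => b p.1 p.2) (0, 0)

/-- `(T, τ)` is the `𝒬`-tensor product of `G` and `H`: the universal continuous bihomomorphism from
`G × H` into a group of the class `𝒬`. -/
structure IsQTensorProduct {G : Type u} {H : Type v} {T : Type w}
    [AddCommGroup G] [TopologicalSpace G] [AddCommGroup H] [TopologicalSpace H]
    [AddCommGroup T] [TopologicalSpace T] (τ : G → H → T) : Prop where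
  isQGroup : IsQGroup T
  isContBihom : IsContBihom τ
  universal : ∀ (B : Type w) [AddCommGroup B] [TopologicalSpace B], IsQGroup B →
    ∀ b : G → H → B, IsContBihom b →
      ∃! β : ContinuousAddMonoidHom T B, ∀ g h, β (τ g h) = b g h

/-- The locally quasi-convex group topologies on the algebraic tensor product for which the
canonical map is a continuous bihomomorphism. -/
structure IsAdmissible (t : TopologicalSpace (G ⊗[ℤ] H)) : Prop where
  isTopologicalAddGroup : IsTopologicalAddGroup (G ⊗[ℤ] H)
  locallyQuasiConvex : IsLocallyQuasiConvex (G ⊗[ℤ] H)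
  isContBihom : IsContBihom fun (g : G) (h : H) => g ⊗ₜ[ℤ] h

/-- The algebraic tensor product, to be topologized by the finest admissible topology. -/
def PreQTensor : Type max u v := G ⊗[ℤ] H

instance : AddCommGroup (PreQTensor G H) := inferInstanceAs (AddCommGroup (G ⊗[ℤ] H))

/-- The finest admissible topology (in Mathlib's order, finer topologies are smaller). -/
instance : TopologicalSpace (PreQTensor G H) :=
  sInf {t : TopologicalSpace (G ⊗[ℤ] H) | IsAdmissible G H t}

instance : IsTopologicalAddGroup (PreQTensor G H) :=
  topologicalAddGroup_sInf (G := G ⊗[ℤ] H) fun _ ht => ht.isTopologicalAddGroup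

/-- `G ⊗_𝒬 H`: the largest Hausdorff quotient (by the closure of `{0}`) of the algebraic tensor
product with its finest admissible topology. -/
abbrev QTensor : Type max u v := SeparationQuotient (PreQTensor G H)

variable {G H}

/-- The canonical map `(g, h) ↦ g ⊗ h` into `G ⊗_𝒬 H`. -/
def QTensor.tmul (g : G) (h : H) : QTensor G H :=
  SeparationQuotient.mk (show PreQTensor G H from g ⊗ₜ[ℤ] h)

end Tensor

end

/-! ### Quasi-convex sets -/

section QuasiConvex

/-! The tensor product exists because local quasi-convexity survives pullbacks, suprema of
topologies and Hausdorff quotients: the finest admissible topology is itself admissible, and a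
bihomomorphism into a group of `𝒬` pulls back to an admissible topology (`isAdmissible_induced`).
For the isomorphism, `Ap.tensorCharacter` is already bijective on the algebraic tensor product.
Onto: `𝕋` has no small subgroups, so a character factors through finitely many evaluations, and
divisibility extends it to some `ℤ^S`. One-to-one: the functions in a tensor are rewritten over a
basis of the subgroup of `ℤ^S` generated by their joint values. Evaluations at points of `A(X)` are
continuous on the tensor product, so by injectivity it is Hausdorff and the quotient changes
nothing. -/

theorem isQuasiConvex_of_forall {G : Type u} [AddCommGroup G] [TopologicalSpace G] {A : Set G}
    (h : ∀ g, (∀ χ : DualGroup G, (∀ a ∈ A, ‖χ a‖ ≤ 1 / 4) → ‖χ g‖ ≤ 1 / 4) → g ∈ A) :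
    IsQuasiConvex A :=
  Set.Subset.antisymm (fun g hg => h g hg) fun a ha _ hχ => hχ a ha

theorem IsQuasiConvex.mem {G : Type u} [AddCommGroup G] [TopologicalSpace G] {A : Set G}
    (hA : IsQuasiConvex A) {g : G}
    (h : ∀ χ : DualGroup G, (∀ a ∈ A, ‖χ a‖ ≤ 1 / 4) → ‖χ g‖ ≤ 1 / 4) : g ∈ A :=
  hA.subset h

/-- A finer topology has more characters, so bipolars can only shrink. -/
theorem IsQuasiConvex.mono {G : Type u} [AddCommGroup G] {t t' : TopologicalSpace G} (h : t' ≤ t)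
    {A : Set G} (hA : @IsQuasiConvex G _ t A) : @IsQuasiConvex G _ t' A :=
  @isQuasiConvex_of_forall G _ t' A fun _ hg => @IsQuasiConvex.mem G _ t A hA _ fun χ hχ =>
    hg (@ContinuousAddMonoidHom.mk G UnitAddCircle _ _ t' _
      (@ContinuousAddMonoidHom.toAddMonoidHom G UnitAddCircle _ _ t _ χ)
      (continuous_le_dom h (@ContinuousAddMonoidHom.continuous_toFun G UnitAddCircle _ _ t _ χ))) hχ

theorem IsQuasiConvex.iInter {G : Type u} [AddCommGroup G] [TopologicalSpace G] {ι : Sort*}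
    {A : ι → Set G} (hA : ∀ i, IsQuasiConvex (A i)) : IsQuasiConvex (⋂ i, A i) :=
  isQuasiConvex_of_forall fun _ hg => Set.mem_iInter.2 fun i => (hA i).mem fun χ hχ =>
    hg χ fun a ha => hχ a (Set.mem_iInter.1 ha i)

theorem IsQuasiConvex.preimage {G : Type u} {B : Type v} [AddCommGroup G] [TopologicalSpace G]
    [AddCommGroup B] [TopologicalSpace B] {A : Set B} (hA : IsQuasiConvex A)
    (β : ContinuousAddMonoidHom G B) : IsQuasiConvex (β ⁻¹' A) :=
  isQuasiConvex_of_forall fun _ hg => hA.mem fun χ hχ =>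
    hg (χ.comp β) fun a ha => hχ (β a) ha

theorem IsLocallyQuasiConvex.induced {G : Type u} {B : Type v} [AddCommGroup G] [AddCommGroup B]
    [t : TopologicalSpace B] (hB : IsLocallyQuasiConvex B) (β : G →+ B) :
    @IsLocallyQuasiConvex G _ (t.induced β) := by
  let _ : TopologicalSpace G := t.induced β
  intro V hV
  rw [nhds_induced, map_zero] at hV
  obtain ⟨W, hW, hWV⟩ := hV
  obtain ⟨U, hU, hUq, hUW⟩ := hB W hW
  refine ⟨β ⁻¹' U, ?_, hUq.preimage ⟨β, continuous_induced_dom⟩,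
    (Set.preimage_mono hUW).trans hWV⟩
  rw [nhds_induced, map_zero]
  exact Filter.preimage_mem_comap hU

/-- Basic neighbourhoods are finite intersections of neighbourhoods from members of `T`; each factor
can be shrunk to a quasi-convex set, which stays so in the finer topology. -/
theorem IsLocallyQuasiConvex.sInf {G : Type u} [AddCommGroup G] {T : Set (TopologicalSpace G)}
    (hT : ∀ t ∈ T, @IsLocallyQuasiConvex G _ t) : @IsLocallyQuasiConvex G _ (sInf T) := by
  let _ : TopologicalSpace G := InfSet.sInf T
  have hn : 𝓝 (0 : G) = ⨅ t : T, @nhds G t.1 0 := by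
    rw [nhds_sInf, iInf_subtype']
  intro V hV
  rw [hn, Filter.mem_iInf] at hV
  obtain ⟨I, hI, W, hW, rfl⟩ := hV
  choose U hU hUq hUW using fun i : I => hT i.1.1 i.1.2 (W i) (hW i)
  refine ⟨⋂ i, U i, ?_, IsQuasiConvex.iInter fun i => (hUq i).mono (sInf_le i.1.2),
    Set.iInter_mono hUW⟩
  rw [hn, Filter.mem_iInf]
  exact ⟨I, hI, U, hU, rfl⟩

/-- The quotient map is open, and every character descends to the quotient because the circle is
Hausdorff. -/
theorem IsLocallyQuasiConvex.separationQuotient {G : Type u} [AddCommGroup G] [TopologicalSpace G]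
    [IsTopologicalAddGroup G] (hG : IsLocallyQuasiConvex G) :
    IsLocallyQuasiConvex (SeparationQuotient G) := by
  intro V hV
  obtain ⟨U, hU, hUq, hUV⟩ :=
    hG (SeparationQuotient.mk ⁻¹' V) (SeparationQuotient.continuous_mk.continuousAt hV)
  refine ⟨SeparationQuotient.mk '' U, SeparationQuotient.isOpenMap_mk.image_mem_nhds hU,
    isQuasiConvex_of_forall fun g hg => ?_, Set.image_subset_iff.2 hUV⟩
  obtain ⟨g, rfl⟩ := SeparationQuotient.surjective_mk g
  refine ⟨g, hUq.mem fun χ hχ => ?_, rfl⟩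
  refine hg ⟨SeparationQuotient.liftContinuousAddMonoidHom χ fun x y h =>
    (h.map χ.continuous_toFun).eq, ContinuousAddMonoidHom.continuous_toFun _⟩ ?_
  rintro _ ⟨a, ha, rfl⟩
  exact hχ a ha

end QuasiConvex

/-! ### The `𝒬`-tensor product exists -/

section Existence

variable {G : Type u} {H : Type v} [AddCommGroup G] [TopologicalSpace G]
  [AddCommGroup H] [TopologicalSpace H]

/-- The homomorphism on the algebraic tensor product induced by a biadditive map. -/
def TensorProduct.liftBiadditive {G : Type u} {H : Type v} {A : Type w} [AddCommGroup G]
    [AddCommGroup H] [AddCommGroup A] (b : G → H → A)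
    (hl : ∀ g g' h, b (g + g') h = b g h + b g' h)
    (hr : ∀ g h h', b g (h + h') = b g h + b g h') : G ⊗[ℤ] H →+ A :=
  TensorProduct.liftAddHom
    (AddMonoidHom.mk' (fun g => AddMonoidHom.mk' (b g) (hr g))
      fun g g' => AddMonoidHom.ext (hl g g'))
    fun n g h => by rw [map_zsmul, map_zsmul, AddMonoidHom.smul_apply]

theorem isAdmissible_induced {B : Type w} [AddCommGroup B] [t : TopologicalSpace B]
    (hB : IsQGroup B) {b : G → H → B} (hb : IsContBihom b) :
    IsAdmissible G H
      (t.induced (TensorProduct.liftBiadditive b hb.add_left hb.add_right)) := by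
  have := hB.isTopologicalAddGroup
  let _ : TopologicalSpace (G ⊗[ℤ] H) :=
    t.induced (TensorProduct.liftBiadditive b hb.add_left hb.add_right)
  refine ⟨topologicalAddGroup_induced _, hB.locallyQuasiConvex.induced _, ?_⟩
  refine ⟨fun _ _ _ => TensorProduct.add_tmul _ _ _, fun _ _ _ => TensorProduct.tmul_add _ _ _,
    fun h => continuous_induced_rng.2 (hb.continuous_left h),
    fun g => continuous_induced_rng.2 (hb.continuous_right g), ?_⟩
  rw [ContinuousAt, nhds_induced, Filter.tendsto_comap_iff]
  exact hb.continuousAt_zero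

/-- The identity map from the algebraic tensor product to its topologized copy. -/
def PreQTensor.of (G : Type u) (H : Type v) [AddCommGroup G] [TopologicalSpace G]
    [AddCommGroup H] [TopologicalSpace H] : G ⊗[ℤ] H ≃+ PreQTensor G H :=
  AddEquiv.refl _

theorem isContBihom_preQTensor_tmul :
    IsContBihom fun (g : G) (h : H) => PreQTensor.of G H (g ⊗ₜ[ℤ] h) where
  add_left _ _ _ := TensorProduct.add_tmul _ _ _
  add_right _ _ _ := TensorProduct.tmul_add _ _ _
  continuous_left h := continuous_sInf_rng.2 fun t ht =>
    let _ : TopologicalSpace (G ⊗[ℤ] H) := t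
    (IsAdmissible.isContBihom ht).continuous_left h
  continuous_right g := continuous_sInf_rng.2 fun t ht =>
    let _ : TopologicalSpace (G ⊗[ℤ] H) := t
    (IsAdmissible.isContBihom ht).continuous_right g
  continuousAt_zero := by
    have h : ∀ t ∈ {t | IsAdmissible G H t}, Filter.Tendsto
        (fun p : G × H => p.1 ⊗ₜ[ℤ] p.2) (𝓝 (0, 0)) (@nhds _ t (0 ⊗ₜ[ℤ] 0)) :=
      fun t ht => let _ := t; (IsAdmissible.isContBihom ht).continuousAt_zero
    have hle : ⨅ t ∈ {t | IsAdmissible G H t}, @nhds _ t (0 ⊗ₜ[ℤ] 0) ≤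
        𝓝 (PreQTensor.of G H (0 ⊗ₜ[ℤ] 0)) :=
      (nhds_sInf (α := G ⊗[ℤ] H)).ge
    exact Filter.Tendsto.mono_right
      (Filter.tendsto_iInf.2 fun t => Filter.tendsto_iInf.2 fun ht => h t ht) hle

theorem isContBihom_tmul :
    IsContBihom (QTensor.tmul : G → H → QTensor G H) where
  add_left g g' h := congrArg SeparationQuotient.mk (isContBihom_preQTensor_tmul.add_left g g' h)
  add_right g h h' := congrArg SeparationQuotient.mk (isContBihom_preQTensor_tmul.add_right g h h')
  continuous_left h :=
    SeparationQuotient.continuous_mk.comp (isContBihom_preQTensor_tmul.continuous_left h)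
  continuous_right g :=
    SeparationQuotient.continuous_mk.comp (isContBihom_preQTensor_tmul.continuous_right g)
  continuousAt_zero :=
    SeparationQuotient.continuous_mk.continuousAt.comp
      isContBihom_preQTensor_tmul.continuousAt_zero

theorem isQGroup_qTensor : IsQGroup (QTensor G H) where
  isTopologicalAddGroup := inferInstance
  t2 := inferInstance
  locallyQuasiConvex :=
    IsLocallyQuasiConvex.separationQuotient
      (IsLocallyQuasiConvex.sInf (G := G ⊗[ℤ] H) fun _ ht => ht.locallyQuasiConvex)

/-- A continuous bihomomorphism into a group of `𝒬` is continuous on the topologized algebraic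
tensor product. -/
def IsContBihom.preLift {B : Type w} [AddCommGroup B] [TopologicalSpace B] (hB : IsQGroup B)
    {b : G → H → B} (hb : IsContBihom b) : ContinuousAddMonoidHom (PreQTensor G H) B where
  toAddMonoidHom := TensorProduct.liftBiadditive b hb.add_left hb.add_right
  continuous_toFun := continuous_sInf_dom (isAdmissible_induced hB hb) continuous_induced_dom

theorem PreQTensor.addHom_ext {B : Type w} [AddCommGroup B] {φ ψ : PreQTensor G H →+ B}
    (h : ∀ g h', φ (PreQTensor.of G H (g ⊗ₜ h')) = ψ (PreQTensor.of G H (g ⊗ₜ h'))) :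
    φ = ψ := by
  refine AddMonoidHom.ext fun x => ?_
  obtain ⟨x, rfl⟩ := (PreQTensor.of G H).surjective x
  induction x using TensorProduct.induction_on with
  | zero => rw [map_zero, map_zero, map_zero]
  | tmul g h' => exact h g h'
  | add x y hx hy => rw [map_add, map_add, map_add, hx, hy]

theorem isQTensorProduct_tmul :
    IsQTensorProduct (QTensor.tmul : G → H → QTensor G H) where
  isQGroup := isQGroup_qTensor
  isContBihom := isContBihom_tmul
  universal B _ _ hB b hb := by
    -- Inseparable points must have equal images for the lift to descend.
    have := hB.t2
    refine ⟨SeparationQuotient.liftContinuousAddMonoidHom (hb.preLift hB) fun x y h =>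
      (h.map (hb.preLift hB).continuous_toFun).eq, fun _ _ => rfl, fun β hβ => ?_⟩
    refine ContinuousAddMonoidHom.ext fun x => ?_
    obtain ⟨x, rfl⟩ := SeparationQuotient.surjective_mk x
    exact DFunLike.congr_fun (PreQTensor.addHom_ext
      (φ := β.toAddMonoidHom.comp SeparationQuotient.mkAddMonoidHom)
      (ψ := (hb.preLift hB).toAddMonoidHom) hβ) x

end Existence

/-! ### Characters of `A_p(X)` -/

section Characters

theorem UnitAddCircle.norm_two_nsmul {x : UnitAddCircle} (hx : ‖x‖ ≤ 1 / 4) :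
    ‖2 • x‖ = 2 * ‖x‖ := by
  obtain ⟨y, rfl⟩ := QuotientAddGroup.mk_surjective x
  obtain ⟨s, hs, hsn⟩ : ∃ s : ℝ, (s : UnitAddCircle) = (y : UnitAddCircle) ∧
      |s| = ‖(y : UnitAddCircle)‖ := by
    refine ⟨y - round y, ?_, UnitAddCircle.norm_eq.symm⟩
    rw [AddCircle.coe_sub, sub_eq_self]
    exact (AddCircle.coe_eq_zero_iff 1).2 ⟨round y, by simp⟩
  change ‖(y : UnitAddCircle)‖ ≤ 1 / 4 at hx
  change ‖2 • (y : UnitAddCircle)‖ = 2 * ‖(y : UnitAddCircle)‖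
  rw [← hsn] at hx ⊢
  have h2 : |2 • s| = 2 * |s| := by rw [nsmul_eq_mul, abs_mul]; simp
  rw [← hs, ← AddCircle.coe_nsmul, ← h2, AddCircle.norm_coe_eq_abs_iff 1 one_ne_zero, h2, abs_one]
  linarith

theorem UnitAddCircle.norm_two_pow_nsmul {x : UnitAddCircle} {n : ℕ}
    (h : ∀ k < n, ‖2 ^ k • x‖ ≤ 1 / 4) : ‖2 ^ n • x‖ = 2 ^ n * ‖x‖ := by
  induction n with
  | zero => simp
  | succ n ih =>
    rw [pow_succ', mul_nsmul', UnitAddCircle.norm_two_nsmul (h n n.lt_succ_self),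
      ih fun k hk => h k (hk.trans n.lt_succ_self)]
    ring

/-- The circle has no small subgroups. -/
theorem UnitAddCircle.eq_zero_of_forall_nsmul {x : UnitAddCircle}
    (h : ∀ n : ℕ, ‖n • x‖ ≤ 1 / 4) : x = 0 := by
  by_contra hx
  obtain ⟨k, hk⟩ := pow_unbounded_of_one_lt (1 / ‖x‖) (one_lt_two (α := ℝ))
  have hpos := norm_pos_iff.2 hx
  rw [div_lt_iff₀ hpos, ← UnitAddCircle.norm_two_pow_nsmul fun k _ => h (2 ^ k)] at hk
  linarith [h (2 ^ k)]

/-- `χ` descends to `A ⧸ E.ker`, which embeds in `B`; divisible groups are injective. -/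
theorem AddMonoidHom.exists_comp_eq_of_ker_le {A B T : Type*} [AddCommGroup A] [AddCommGroup B]
    [AddCommGroup T] [DivisibleBy T ℤ] (E : A →+ B) (χ : A →+ T) (h : E.ker ≤ χ.ker) :
    ∃ φ : B →+ T, φ.comp E = χ := by
  obtain ⟨φ, hφ⟩ := (Module.Baer.of_divisible T).extension_property_addMonoidHom
    (QuotientAddGroup.kerLift E) (QuotientAddGroup.kerLift_injective E)
    (QuotientAddGroup.lift E.ker χ h)
  exact ⟨φ, AddMonoidHom.ext fun a => DFunLike.congr_fun hφ (a : A ⧸ E.ker)⟩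

variable {X : Type u}

/-- The generators of `A_p(X)`. -/
def Ap.of (x : X) : Ap X := FreeAbelianGroup.of x

@[simp]
theorem Ap.eval_of (f : X → ℤ) (x : X) : Ap.eval f (Ap.of x) = f x :=
  FreeAbelianGroup.lift_apply_of f x

theorem Ap.eval_add (f g : X → ℤ) (a : Ap X) :
    Ap.eval (f + g) a = Ap.eval f a + Ap.eval g a :=
  FreeAbelianGroup.lift_add_apply f g a

variable [TopologicalSpace X]

theorem Ap.continuous_eval (f : Cp X) : Continuous (Ap.eval f.1 : Ap X → ℤ) :=
  (continuous_apply f).comp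
    (continuous_induced_dom (f := fun (a : Ap X) (f : Cp X) => Ap.eval f.1 a))

theorem Cp.continuous_eval (a : Ap X) : Continuous fun f : Cp X => Ap.eval f.1 a := by
  refine FreeAbelianGroup.induction_on (motive := fun a : FreeAbelianGroup X =>
    Continuous fun f : Cp X => FreeAbelianGroup.lift f.1 a) a ?_ ?_ ?_ ?_
  · simp only [map_zero]
    exact continuous_const
  · intro x
    simp only [FreeAbelianGroup.lift_apply_of]
    exact (continuous_apply x).comp continuous_subtype_val
  · intro x h
    simp only [map_neg]
    exact h.neg
  · intro x y hx hy
    simp only [map_add]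
    exact hx.add hy

/-- The character `a ↦ ⟨a, f⟩ t` of `A_p(X)`. -/
def Ap.character (f : Cp X) (t : UnitAddCircle) : DualGroup (Ap X) where
  toAddMonoidHom := ((smulAddHom ℤ UnitAddCircle).flip t).comp (Ap.eval f.1)
  continuous_toFun :=
    (continuous_of_discreteTopology (f := fun n : ℤ => n • t)).comp (Ap.continuous_eval f)

/-- The homomorphism from the algebraic tensor product with `f ⊗ t ↦ (a ↦ ⟨a, f⟩ t)`. -/
def Ap.tensorCharacter : PreQTensor (Cp X) UnitAddCircle →+ DualGroup (Ap X) :=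
  TensorProduct.liftBiadditive Ap.character
    (fun f g t => ContinuousAddMonoidHom.ext fun a => by
      change Ap.eval (f.1 + g.1) a • t = Ap.eval f.1 a • t + Ap.eval g.1 a • t
      rw [Ap.eval_add, add_smul])
    fun f s t => ContinuousAddMonoidHom.ext fun a => smul_add (Ap.eval f.1 a) s t

theorem Ap.tensorCharacter_sum_apply {ι : Type*} (s : Finset ι) (f : ι → Cp X)
    (t : ι → UnitAddCircle) (a : Ap X) :
    Ap.tensorCharacter (PreQTensor.of _ _ (∑ i ∈ s, f i ⊗ₜ[ℤ] t i)) a =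
      ∑ i ∈ s, Ap.eval (f i).1 a • t i := by
  let ev : DualGroup (Ap X) →+ UnitAddCircle := AddMonoidHom.mk' (fun χ => χ a) fun _ _ => rfl
  exact map_sum ((ev.comp Ap.tensorCharacter).comp (PreQTensor.of _ _).toAddMonoidHom)
    (fun i => f i ⊗ₜ[ℤ] t i) s

theorem Ap.exists_finset_ker_le (χ : DualGroup (Ap X)) :
    ∃ S : Finset (Cp X), ∀ a, (∀ f ∈ S, Ap.eval f.1 a = 0) → χ a = 0 := by
  have hV : χ ⁻¹' Metric.ball 0 (1 / 4) ∈ 𝓝 (0 : Ap X) :=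
    χ.continuous_toFun.continuousAt
      (by simpa using Metric.ball_mem_nhds (0 : UnitAddCircle) (by norm_num))
  rw [nhds_induced, Filter.mem_comap] at hV
  obtain ⟨W, hW, hWV⟩ := hV
  rw [nhds_pi, Filter.mem_pi] at hW
  obtain ⟨I, hI, t, ht, htW⟩ := hW
  refine ⟨hI.toFinset, fun a ha => UnitAddCircle.eq_zero_of_forall_nsmul fun n => ?_⟩
  -- The basic neighbourhood restricts only the evaluations in `I`, which vanish on every multiple
  -- of `a`.
  have hn : n • a ∈ χ ⁻¹' Metric.ball 0 (1 / 4) := by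
    refine hWV (htW fun f hf => ?_)
    have h0 : Ap.eval f.1 (n • a) = Ap.eval f.1 (0 : Ap X) := by
      rw [map_nsmul, ha f (hI.mem_toFinset.2 hf), smul_zero, map_zero]
    simpa only [h0] using mem_of_mem_nhds (ht f)
  rw [Set.mem_preimage, mem_ball_zero_iff, map_nsmul] at hn
  exact hn.le

theorem Ap.tensorCharacter_surjective :
    Function.Surjective (Ap.tensorCharacter (X := X)) := by
  classical
  intro χ
  obtain ⟨S, hS⟩ := Ap.exists_finset_ker_le χ
  let E : Ap X →+ (S → ℤ) := AddMonoidHom.pi fun f => Ap.eval f.1.1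
  obtain ⟨φ, hφ⟩ := E.exists_comp_eq_of_ker_le χ.toAddMonoidHom fun a ha =>
    hS a fun f hf => congrFun ha ⟨f, hf⟩
  -- A homomorphism on `ℤ^S` is determined by its values on the unit vectors; these are the circle
  -- coefficients.
  refine ⟨PreQTensor.of _ _ (∑ f : S, f.1 ⊗ₜ[ℤ] φ (Pi.single f 1)),
    ContinuousAddMonoidHom.ext fun a => ?_⟩
  rw [Ap.tensorCharacter_sum_apply]
  have h : φ (E a) = χ a := DFunLike.congr_fun hφ a
  rw [← h]
  conv_rhs => rw [← Finset.univ_sum_single (E a), map_sum]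
  refine Finset.sum_congr rfl fun f _ => ?_
  rw [← map_zsmul, ← Pi.single_smul, smul_eq_mul, mul_one]
  rfl

theorem Ap.tensorCharacter_injective :
    Function.Injective (Ap.tensorCharacter (X := X)) := by
  classical
  refine (injective_iff_map_eq_zero _).2 fun z hz => ?_
  obtain ⟨z, rfl⟩ := (PreQTensor.of _ _).surjective z
  obtain ⟨S, rfl⟩ := TensorProduct.exists_finset z
  rw [← Finset.sum_coe_sort] at hz ⊢
  let F : X → S → ℤ := fun x i => i.1.1.1 x
  have hF : Continuous F := continuous_pi fun i => i.1.1.2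
  let ψ : (S → ℤ) →ₗ[ℤ] UnitAddCircle :=
    ∑ i : S, (LinearMap.proj i : (S → ℤ) →ₗ[ℤ] ℤ).smulRight i.1.2
  have hψ : ∀ v, ψ v = ∑ i : S, v i • i.1.2 := fun v => by
    simp [ψ, LinearMap.sum_apply]
  let L : Submodule ℤ (S → ℤ) := Submodule.span ℤ (Set.range F)
  -- The character vanishes at each generator `x`, which says `ψ (F x) = 0`.
  have hL : L ≤ LinearMap.ker ψ := by
    refine Submodule.span_le.2 ?_
    rintro _ ⟨x, rfl⟩
    have h := DFunLike.congr_fun hz (Ap.of x)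
    rw [Ap.tensorCharacter_sum_apply] at h
    simp only [Ap.eval_of] at h
    exact (hψ _).trans h
  let b := Module.Free.chooseBasis ℤ L
  let FL : X → L := fun x => ⟨F x, Submodule.subset_span ⟨x, rfl⟩⟩
  have hFL : Continuous FL := hF.subtype_mk _
  -- The coordinates of `F x` in the basis of `L` are continuous in `x` because `L` is discrete.
  -- Moving the integer coefficients across the tensor sign leaves the terms `g j ⊗ ψ (b j)`, all
  -- zero.
  let g : Module.Free.ChooseBasisIndex ℤ L → Cp X := fun j =>
    ⟨fun x => b.repr (FL x) j,
      (continuous_of_discreteTopology (f := fun v : L => b.repr v j)).comp hFL⟩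
  have hfg : ∀ i : S, i.1.1 = ∑ j, (b j).1 i • g j := fun i => by
    ext x
    have h : (∑ j, b.repr (FL x) j • (b j).1) i = F x i := by
      have h := congrArg L.subtype (b.sum_repr (FL x))
      rw [map_sum] at h
      exact congrFun h i
    rw [show i.1.1.1 x = F x i from rfl, ← h]
    simp [g, mul_comm]
  have h0 : ∑ i : S, i.1.1 ⊗ₜ[ℤ] i.1.2 = 0 := by
    calc ∑ i : S, i.1.1 ⊗ₜ[ℤ] i.1.2
        = ∑ i : S, ∑ j, g j ⊗ₜ[ℤ] ((b j).1 i • i.1.2) :=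
          Finset.sum_congr rfl fun i _ => by
            conv_lhs => rw [hfg i, TensorProduct.sum_tmul]
            exact Finset.sum_congr rfl fun j _ => TensorProduct.smul_tmul _ _ _
      _ = ∑ j, g j ⊗ₜ[ℤ] ψ (b j).1 := by
          rw [Finset.sum_comm]
          exact Finset.sum_congr rfl fun j _ => by rw [hψ, TensorProduct.tmul_sum]
      _ = 0 := Finset.sum_eq_zero fun j _ => by
          rw [LinearMap.mem_ker.1 (hL (b j).2), TensorProduct.tmul_zero]
  rw [h0, map_zero]

end Characters

/-! ### The isomorphism -/

section Isomorphism

theorem UnitAddCircle.norm_le_of_forall_two_pow_nsmul {x : UnitAddCircle} {n : ℕ}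
    (h : ∀ k ≤ n, ‖2 ^ k • x‖ ≤ 1 / 4) : 2 ^ n * ‖x‖ ≤ 1 / 4 := by
  rw [← UnitAddCircle.norm_two_pow_nsmul fun k hk => h k hk.le]
  exact h n le_rfl

theorem UnitAddCircle.isLocallyQuasiConvex : IsLocallyQuasiConvex UnitAddCircle := by
  intro V hV
  obtain ⟨ε, hε, hεV⟩ := Metric.mem_nhds_iff.1 hV
  -- Keeping `2 ^ k • x` within `1 / 4` for all `k ≤ n` forces `‖x‖ ≤ 2 ^ (-n) / 4 < ε`.
  obtain ⟨n, hn⟩ := pow_unbounded_of_one_lt (1 / ε) (one_lt_two (α := ℝ))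
  let pow (k : Fin (n + 1)) : DualGroup UnitAddCircle :=
    ⟨nsmulAddMonoidHom (2 ^ (k : ℕ)), continuous_nsmul _⟩
  refine ⟨⋂ k, pow k ⁻¹' Metric.closedBall 0 (1 / 4), Filter.iInter_mem.2 fun k => ?_,
    IsQuasiConvex.iInter fun k => isQuasiConvex_of_forall fun g hg => ?_, fun x hx => hεV ?_⟩
  · exact (pow k).continuous_toFun.continuousAt
      (by simpa using Metric.closedBall_mem_nhds (0 : UnitAddCircle) (by norm_num))
  · exact mem_closedBall_zero_iff.2 (hg (pow k) fun a ha => mem_closedBall_zero_iff.1 ha)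
  · rw [mem_ball_zero_iff]
    have h := UnitAddCircle.norm_le_of_forall_two_pow_nsmul (x := x) (n := n) fun k hk =>
      mem_closedBall_zero_iff.1 (Set.mem_iInter.1 hx ⟨k, Nat.lt_succ_of_le hk⟩)
    rw [div_lt_iff₀ hε] at hn
    have h2 : (0 : ℝ) < 2 ^ n := by positivity
    exact lt_of_mul_lt_mul_left (by linarith) h2.le

theorem UnitAddCircle.isQGroup : IsQGroup UnitAddCircle :=
  ⟨inferInstance, inferInstance, UnitAddCircle.isLocallyQuasiConvex⟩

variable {X : Type u} [TopologicalSpace X]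

theorem isContBihom_eval_smul (a : Ap X) :
    IsContBihom fun (f : Cp X) (t : UnitAddCircle) => Ap.eval f.1 a • t where
  add_left f g t := by
    rw [← add_smul, ← Ap.eval_add]
    rfl
  add_right f s t := smul_add _ s t
  continuous_left t :=
    (continuous_of_discreteTopology (f := fun n : ℤ => n • t)).comp (Cp.continuous_eval a)
  continuous_right f := continuous_zsmul _
  continuousAt_zero := by
    have h0 : Ap.eval (0 : Cp X).1 a = 0 := by
      simpa using Ap.eval_add (0 : X → ℤ) 0 a
    -- Since `ℤ` is discrete, the map is identically zero near the origin.
    have h : ∀ᶠ p : Cp X × UnitAddCircle in 𝓝 (0, 0), Ap.eval p.1.1 a = 0 :=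
      ((isOpen_discrete {0}).preimage
        ((Cp.continuous_eval a).comp continuous_fst)).mem_nhds h0
    refine ContinuousAt.congr (f := fun _ => 0) continuousAt_const ?_
    filter_upwards [h] with p hp
    rw [hp, zero_smul]

/-- For fixed `a`, the value of the character at `a` is the continuous lift of a bihomomorphism into
the Hausdorff group `𝕋`, so it cannot distinguish `z` from `0`. -/
theorem Ap.tensorCharacter_eq_zero_of_inseparable {z : PreQTensor (Cp X) UnitAddCircle}
    (hz : Inseparable z 0) : Ap.tensorCharacter z = 0 := by
  refine ContinuousAddMonoidHom.ext fun a => ?_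
  let β := (isContBihom_eval_smul a).preLift UnitAddCircle.isQGroup
  let ev : DualGroup (Ap X) →+ UnitAddCircle := AddMonoidHom.mk' (fun χ => χ a) fun _ _ => rfl
  have hβ : β.toAddMonoidHom = ev.comp Ap.tensorCharacter := PreQTensor.addHom_ext fun _ _ => rfl
  have h : β z = β 0 := (hz.map β.continuous_toFun).eq
  rw [map_zero] at h
  exact (DFunLike.congr_fun hβ z).symm.trans h

/-- The finest admissible topology on `C_p(X, ℤ) ⊗ 𝕋` is Hausdorff. -/
instance : T0Space (PreQTensor (Cp X) UnitAddCircle) where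
  t0 x y h := by
    rw [← sub_eq_zero]
    refine (injective_iff_map_eq_zero _).1 Ap.tensorCharacter_injective _
      (Ap.tensorCharacter_eq_zero_of_inseparable ?_)
    simpa using h.map (continuous_id.sub continuous_const : Continuous fun z => z - y)

theorem exists_addEquiv_dualGroup (X : Type u) [TopologicalSpace X] :
    ∃ θ : QTensor (Cp X) UnitAddCircle ≃+ DualGroup (Ap X),
      ∀ (f : Cp X) (t : UnitAddCircle) (a : Ap X),
        θ (QTensor.tmul f t) a = Ap.eval f.1 a • t := by
  let q : PreQTensor (Cp X) UnitAddCircle ≃+ QTensor (Cp X) UnitAddCircle :=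
    AddEquiv.ofBijective SeparationQuotient.mkAddMonoidHom
      ⟨fun _ _ h => (SeparationQuotient.mk_eq_mk.1 h).eq, SeparationQuotient.surjective_mk⟩
  let Φ : PreQTensor (Cp X) UnitAddCircle ≃+ DualGroup (Ap X) :=
    AddEquiv.ofBijective Ap.tensorCharacter
      ⟨Ap.tensorCharacter_injective, Ap.tensorCharacter_surjective⟩
  refine ⟨q.symm.trans Φ, fun f t a => ?_⟩
  have h : q.symm (QTensor.tmul f t) = PreQTensor.of _ _ (f ⊗ₜ t) := q.symm_apply_eq.2 rfl
  rw [AddEquiv.trans_apply, h]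
  rfl

end Isomorphism

theorem theoremB (X : Type u) [TopologicalSpace X] [T2Space X]
    (hX : IsZeroDim X) (hk : IsKNSpace X) :
    IsQTensorProduct (QTensor.tmul : Cp X → UnitAddCircle → QTensor (Cp X) UnitAddCircle) ∧
    ∃ θ : QTensor (Cp X) UnitAddCircle ≃+ DualGroup (Ap X),
      ∀ (f : Cp X) (t : UnitAddCircle) (a : Ap X),
        θ (QTensor.tmul f t) a = Ap.eval f.1 a • t := by
  exact ⟨isQTensorProduct_tmul, exists_addEquiv_dualGroup X⟩
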